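/- Let $\lfloor\cdot\rceil:\mathbb C\setminus\{0\}\to\mathbb Z[i]$ be a nearest integer (Hurwitz) function, i.e. $\lfloor z\rceil$ is a Gaussian integer closest to $z$, with any convention for ties. Put $S(z)=-1/z$ for $z\ne0$, let $K=\overline{\{z-\lfloor z\rceil : z\in\mathbb C\setminus\{0\}\}}$, and let $G$ be the Gauss map $G(z)=S(z)-\lfloor S(z)\rceil$ for $z\neq 0$, $G(0)=0$. For a set $X\subseteq\mathbb C$ write $S(X)=\{S(z): z\in X\setminus\{0\}\}$. Then $|z-\lfloor z\rceil|\le 1$ for all $z\ne0$, and $K=\{z:|\mathrm{Re}\,z|\le\tfrac12,\ |\mathrm{Im}\,z|\le\tfrac12\}$. Define $$K_1=\{z\in K: \mathrm{Re}\,z\le 0,\ |z-i|\ge1,\ |z+i|\ge1\},$$ $$K_2=\{z\in K: |z-i|\le1,\ |z+1|\le1,\ |z-(-1+i)|\ge1\},$$ $$K_3=\{z\in K: |z-(-1+i)|\le1\},\qquad K_j=-i\,K_{j-3}\quad(j\ge4),$$ so that $K_1,\dots,K_{12}$ are twelve sets in the unit square. **Proposition.** The nearest integer algorithm satisfies the finite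 building property with $\{K_1,\dots,K_{12}\}$. That is, the $K_j$ ($1\le j\le12$) are nonempty closed sets whose boundaries have Lebesgue measure zero, they have pairwise disjoint interiors, their union is $K$, and each $G(K_j)$, $1\le j\le 12$, is equal, up to Lebesgue measure zero, to a union of some of the sets $K_1,\dots,K_{12}$. Moreover, for each $1\le i\le12$ the set $S(K_i)$ is exactly a union of translates $a+K_j$ with $a\in\mathbb Z[i]$, $1\le j\le12$. Explicitly, $$S(K_1)=\Big(2+\bigcup_{j=4}^{10}K_j\Big)\cup\bigcup_{n\in\mathbb Z,\ n\ge3}(n+K),$$ $$S(K_2)=\Big(2+i+\bigcup_{j=4}^{10}K_j\Big)\cup\Big(1+2i+\bigcup_{j=1}^{7}K_j\Big)\cup\Big(2+2i+\bigcup_{j=1}^{11}K_j\Big)\cup\bigcup_{\substack{n,m\in\mathbb Z\\ \min\{m,n\}\ge1,\ \max\{m,n\}\ge3}}(n+mi+K),$$ $$S(K_3)=\Big(1+i+\bigcup_{j=4}^{7}K_j\Big)\cup\Big(2+i+\bigcup_{j\in\{1,2,3,11\}}K_j\Big)\cup\Big(1+2i+\bigcup_{j=8}^{11}K_j\Big)\cup\big(2+2i+K_{12}\big),$$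 and $S(K_{i+3})=i\cdot S(K_i)$ for every index $i\ge1$ (where the factor $i$ is the imaginary unit). -/

import Mathlib

open MeasureTheory

/-- A choice function assigns to every nonzero complex number a Gaussian integer at distance at
most one. It is represented by a total function, whose value at `0` is never used. -/
def IsChoiceFunction (br : ℂ → GaussianInt) : Prop :=
  ∀ z : ℂ, z ≠ 0 → ‖z - (br z : ℂ)‖ ≤ 1

/-- `br` is a nearest integer (Hurwitz) function: it assigns to each nonzero `z` a Gaussian integer
closest to `z`. Any convention is allowed where several Gaussian integers are equally close. -/
def IsNearestInteger (br : ℂ → GaussianInt) : Prop :=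
  ∀ z : ℂ, z ≠ 0 → ∀ a : GaussianInt, ‖z - (br z : ℂ)‖ ≤ ‖z - (a : ℂ)‖

/-- The fundamental set `K` of a choice function. -/
def fundamentalSet (br : ℂ → GaussianInt) : Set ℂ :=
  closure {w : ℂ | ∃ z : ℂ, z ≠ 0 ∧ w = z - (br z : ℂ)}

/-- The inversion `S z = -1 / z` (meaningful for `z ≠ 0`). -/
noncomputable def invS (z : ℂ) : ℂ := -1 / z

/-- The Gauss map: `G z = S z - ⌊S z⌋` for `z ≠ 0`, and `G 0 = 0`. -/
noncomputable def gaussMap (br : ℂ → GaussianInt) (z : ℂ) : ℂ :=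
  open Classical in if z = 0 then 0 else invS z - (br (invS z) : ℂ)

/-- The set `s` is, up to Lebesgue measure zero, a union of elements of the collection `C`. -/
def IsBuildable (C : Set (Set ℂ)) (s : Set ℂ) : Prop :=
  ∃ D : Set (Set ℂ), D ⊆ C ∧ s =ᵐ[volume] ⋃₀ D

/-- `P` is a finite partition of `K` into nonempty closed sets with null boundaries; as for Markov
partitions, only the interiors of different pieces have to be disjoint. -/
structure IsClosedPartition {N : ℕ} (P : Fin N → Set ℂ) (K : Set ℂ) : Prop where
  nonempty : ∀ i, (P i).Nonempty
  isClosed : ∀ i, IsClosed (P i)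
  null_frontier : ∀ i, volume (frontier (P i)) = 0
  iUnion_eq : ⋃ i, P i = K
  disjoint_interior : ∀ i j, i ≠ j → Disjoint (interior (P i)) (interior (P j))

/-- The algorithm given by `br` satisfies the finite building property with the partition `P`. -/
def FiniteBuildingPropertyWith (br : ℂ → GaussianInt) {N : ℕ} (P : Fin N → Set ℂ) : Prop :=
  1 < N ∧ IsClosedPartition P (fundamentalSet br) ∧
    ∀ i, IsBuildable (Set.range P) (gaussMap br '' P i)

/-- The closed unit square centered at the origin. -/
def unitSquare : Set ℂ := {z : ℂ | |z.re| ≤ 1 / 2 ∧ |z.im| ≤ 1 / 2}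

/-- The pieces `K_1, …, K_12` of the unit square, indexed by their usual numbers (the index `0` is
unused): `K_1`, `K_2`, `K_3` are explicit and `K_i = -i K_{i-3}` for larger indices. -/
def hurwitzK : ℕ → Set ℂ
  | 0 => ∅
  | 1 => {z ∈ unitSquare | z.re ≤ 0 ∧ 1 ≤ ‖z - Complex.I‖ ∧ 1 ≤ ‖z + Complex.I‖}
  | 2 => {z ∈ unitSquare |
      ‖z - Complex.I‖ ≤ 1 ∧ ‖z + 1‖ ≤ 1 ∧ 1 ≤ ‖z - (-1 + Complex.I)‖}
  | 3 => {z ∈ unitSquare | ‖z - (-1 + Complex.I)‖ ≤ 1}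
  | n + 4 => (fun z : ℂ => -Complex.I * z) '' hurwitzK (n + 1)

/-- The family `(K_1, …, K_12)`. -/
def hurwitzPartition (i : Fin 12) : Set ℂ := hurwitzK ((i : ℕ) + 1)

/-- The translate `a + s` of a set by a Gaussian integer. -/
def gaussTranslate (a : GaussianInt) (s : Set ℂ) : Set ℂ := (fun z : ℂ => (a : ℂ) + z) '' s

/-- The image under `S` of the nonzero points of `s`. -/
def imageS (s : Set ℂ) : Set ℂ := invS '' (s \ {0})

open Complex

/-! Each piece is cut out of the square by unit circles around the eight Gaussian integers of norm 1
or √2, so membership is a system of inequalities linear in `z.re`, `z.im` and `normSq z`. Under `S`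
these become `-w.re`, `w.im` and `1`, all divided by `normSq w`, so such inequalities are carried to
inequalities of the same kind. Circles through 0 become lines Re w = ±1/2 or Im w = ±1/2, the sides
of the square become unit circles around ±1 and ±i, and the circle around -1+i becomes the one
around 1+i.

Hence S(K_1), S(K_2), S(K_3) are bounded by lines of the half-integer grid and by unit circles
around Gaussian integers. Inside each grid cell a+K those circles run along boundaries of the
translated pieces, which gives the explicit formulas. The other nine follow from S(-iz) = i S(z).

For the building property, a point interior to a grid cell has a forced nearest integer. Up to the
null boundary of the square and the point 0, G(K_i) is therefore the union of the K_j whose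
translates occur in S(K_i). -/

/-! ### Polynomial descriptions of the twelve pieces -/

theorem mem_unitSquare {z : ℂ} : z ∈ unitSquare ↔
    (-1 / 2 ≤ z.re ∧ z.re ≤ 1 / 2) ∧ (-1 / 2 ≤ z.im ∧ z.im ≤ 1 / 2) := by
  simp only [unitSquare, Set.mem_ofPred_eq, abs_le, neg_div]

theorem unitSquare_eq_reProdIm :
    unitSquare = Set.Icc (-1 / 2 : ℝ) (1 / 2) ×ℂ Set.Icc (-1 / 2 : ℝ) (1 / 2) := by
  ext z
  simp [mem_unitSquare, mem_reProdIm]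

theorem one_le_norm_sub_iff (z c : ℂ) : 1 ≤ ‖z - c‖ ↔
    1 ≤ normSq z - 2 * (z.re * c.re + z.im * c.im) + normSq c := by
  rw [← one_le_sq_iff₀ (norm_nonneg _), Complex.sq_norm]
  simp only [normSq_apply, sub_re, sub_im]
  constructor <;> intro h <;> linarith

theorem norm_sub_le_one_iff (z c : ℂ) : ‖z - c‖ ≤ 1 ↔
    normSq z - 2 * (z.re * c.re + z.im * c.im) + normSq c ≤ 1 := by
  rw [← sq_le_one_iff₀ (norm_nonneg _), Complex.sq_norm]
  simp only [normSq_apply, sub_re, sub_im]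
  constructor <;> intro h <;> linarith

/-- Since x² ≤ |x|/2 for |x| ≤ 1/2, the squared norm is at most the larger of |Re z|, |Im z|. So the
unit discs around ±1 and ±i cover the square. -/
theorem normSq_le_of_mem_unitSquare {z : ℂ} (hz : z ∈ unitSquare) :
    normSq z ≤ z.re ∨ normSq z ≤ -z.re ∨ normSq z ≤ z.im ∨ normSq z ≤ -z.im := by
  obtain ⟨⟨h1, h2⟩, h3, h4⟩ := mem_unitSquare.1 hz
  have hx : z.re * z.re ≤ |z.re| / 2 := by
    rw [← abs_mul_abs_self]
    nlinarith [abs_nonneg z.re, abs_le.2 ⟨by linarith, h2⟩]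
  have hy : z.im * z.im ≤ |z.im| / 2 := by
    rw [← abs_mul_abs_self]
    nlinarith [abs_nonneg z.im, abs_le.2 ⟨by linarith, h4⟩]
  rw [normSq_apply]
  by_contra! h
  rcases abs_cases z.re with ⟨e, _⟩ | ⟨e, _⟩ <;> rcases abs_cases z.im with ⟨f, _⟩ | ⟨f, _⟩ <;>
    rw [e] at hx <;> rw [f] at hy <;> linarith

/-- The half-plane condition is traded for |z+1| ≤ 1, which is equivalent here, so that all pieces
are described by circles alone. -/
theorem mem_hurwitzK_one {z : ℂ} : z ∈ hurwitzK 1 ↔ z ∈ unitSquare ∧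
    normSq z ≤ -2 * z.re ∧ 2 * z.im ≤ normSq z ∧ -2 * z.im ≤ normSq z := by
  have h0 := normSq_nonneg z
  have e : z + I = z - -I := by ring
  simp only [hurwitzK, Set.mem_sep_iff, e, one_le_norm_sub_iff]
  simp only [neg_re, neg_im, I_re, I_im, normSq_neg, normSq_I]
  refine and_congr_right fun hz => ⟨fun ⟨h1, h2, h3⟩ => ?_, fun ⟨h1, h2, h3⟩ => ?_⟩
  · refine ⟨?_, by linarith, by linarith⟩
    rcases normSq_le_of_mem_unitSquare hz with h | h | h | h <;> linarith
  · refine ⟨by linarith, by linarith, by linarith⟩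

theorem mem_hurwitzK_two {z : ℂ} : z ∈ hurwitzK 2 ↔ z ∈ unitSquare ∧
    normSq z ≤ 2 * z.im ∧ normSq z ≤ -2 * z.re ∧ 0 ≤ normSq z + 2 * z.re - 2 * z.im + 1 := by
  have e : z + 1 = z - -1 := by ring
  simp only [hurwitzK, Set.mem_sep_iff, e, one_le_norm_sub_iff, norm_sub_le_one_iff]
  simp only [normSq_apply, neg_re, neg_im, I_re, I_im, add_re, add_im, one_re, one_im]
  refine and_congr_right fun hz => ⟨fun ⟨h1, h2, h3⟩ => ?_, fun ⟨h1, h2, h3⟩ => ?_⟩ <;>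
    refine ⟨by linarith, by linarith, by linarith⟩

theorem mem_hurwitzK_three {z : ℂ} : z ∈ hurwitzK 3 ↔ z ∈ unitSquare ∧
    normSq z + 2 * z.re - 2 * z.im + 1 ≤ 0 := by
  simp only [hurwitzK, Set.mem_sep_iff, norm_sub_le_one_iff]
  simp only [normSq_apply, neg_re, neg_im, I_re, I_im, add_re, add_im, one_re, one_im]
  refine and_congr_right fun hz => ⟨fun h => ?_, fun h => ?_⟩ <;> linarith

theorem image_neg_I_mul (s : Set ℂ) : (fun z : ℂ => -I * z) '' s = (fun z : ℂ => I * z) ⁻¹' s := by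
  ext z
  constructor
  · rintro ⟨w, hw, rfl⟩
    simpa [← mul_assoc] using hw
  · intro hz
    exact ⟨I * z, hz, by simp [← mul_assoc]⟩

theorem image_I_mul (s : Set ℂ) : (fun z : ℂ => I * z) '' s = (fun z : ℂ => -I * z) ⁻¹' s := by
  ext z
  constructor
  · rintro ⟨w, hw, rfl⟩
    simpa [← mul_assoc] using hw
  · intro hz
    exact ⟨-I * z, hz, by simp [← mul_assoc]⟩

theorem hurwitzK_add_four (n : ℕ) :
    hurwitzK (n + 4) = (fun z : ℂ => I * z) ⁻¹' hurwitzK (n + 1) := by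
  rw [hurwitzK, image_neg_I_mul]

theorem I_mul_mem_unitSquare {z : ℂ} : I * z ∈ unitSquare ↔ z ∈ unitSquare := by
  simp only [unitSquare, Set.mem_ofPred_eq, I_mul_re, I_mul_im, abs_neg]
  exact and_comm

theorem normSq_I_mul (z : ℂ) : normSq (I * z) = normSq z := by simp

theorem mem_hurwitzK_four {z : ℂ} : z ∈ hurwitzK 4 ↔ z ∈ unitSquare ∧
    normSq z ≤ 2 * z.im ∧ 2 * z.re ≤ normSq z ∧ -2 * z.re ≤ normSq z := by
  rw [hurwitzK_add_four 0, Set.mem_preimage, mem_hurwitzK_one, I_mul_mem_unitSquare, normSq_I_mul,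
    I_mul_re, I_mul_im, neg_mul_neg]

theorem mem_hurwitzK_five {z : ℂ} : z ∈ hurwitzK 5 ↔ z ∈ unitSquare ∧
    normSq z ≤ 2 * z.re ∧ normSq z ≤ 2 * z.im ∧ 0 ≤ normSq z - 2 * z.im - 2 * z.re + 1 := by
  rw [hurwitzK_add_four 1, Set.mem_preimage, mem_hurwitzK_two, I_mul_mem_unitSquare, normSq_I_mul,
    I_mul_re, I_mul_im, neg_mul_neg, mul_neg, ← sub_eq_add_neg]

theorem mem_hurwitzK_six {z : ℂ} : z ∈ hurwitzK 6 ↔ z ∈ unitSquare ∧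
    normSq z - 2 * z.im - 2 * z.re + 1 ≤ 0 := by
  rw [hurwitzK_add_four 2, Set.mem_preimage, mem_hurwitzK_three, I_mul_mem_unitSquare, normSq_I_mul,
    I_mul_re, I_mul_im, mul_neg, ← sub_eq_add_neg]

theorem mem_hurwitzK_seven {z : ℂ} : z ∈ hurwitzK 7 ↔ z ∈ unitSquare ∧
    normSq z ≤ 2 * z.re ∧ -2 * z.im ≤ normSq z ∧ 2 * z.im ≤ normSq z := by
  rw [hurwitzK_add_four 3, Set.mem_preimage, mem_hurwitzK_four, I_mul_mem_unitSquare, normSq_I_mul,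
    I_mul_re, I_mul_im, neg_mul_neg, mul_neg, neg_mul]

theorem mem_hurwitzK_eight {z : ℂ} : z ∈ hurwitzK 8 ↔ z ∈ unitSquare ∧
    normSq z ≤ -2 * z.im ∧ normSq z ≤ 2 * z.re ∧ 0 ≤ normSq z - 2 * z.re + 2 * z.im + 1 := by
  rw [hurwitzK_add_four 4, Set.mem_preimage, mem_hurwitzK_five, I_mul_mem_unitSquare, normSq_I_mul,
    I_mul_re, I_mul_im, mul_neg, sub_neg_eq_add, neg_mul]

theorem mem_hurwitzK_nine {z : ℂ} : z ∈ hurwitzK 9 ↔ z ∈ unitSquare ∧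
    normSq z - 2 * z.re + 2 * z.im + 1 ≤ 0 := by
  rw [hurwitzK_add_four 5, Set.mem_preimage, mem_hurwitzK_six, I_mul_mem_unitSquare, normSq_I_mul,
    I_mul_re, I_mul_im, mul_neg, sub_neg_eq_add]

theorem mem_hurwitzK_ten {z : ℂ} : z ∈ hurwitzK 10 ↔ z ∈ unitSquare ∧
    normSq z ≤ -2 * z.im ∧ -2 * z.re ≤ normSq z ∧ 2 * z.re ≤ normSq z := by
  rw [hurwitzK_add_four 6, Set.mem_preimage, mem_hurwitzK_seven, I_mul_mem_unitSquare, normSq_I_mul,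
    I_mul_re, I_mul_im, mul_neg, ← neg_mul]

theorem mem_hurwitzK_eleven {z : ℂ} : z ∈ hurwitzK 11 ↔ z ∈ unitSquare ∧
    normSq z ≤ -2 * z.re ∧ normSq z ≤ -2 * z.im ∧ 0 ≤ normSq z + 2 * z.im + 2 * z.re + 1 := by
  rw [hurwitzK_add_four 7, Set.mem_preimage, mem_hurwitzK_eight, I_mul_mem_unitSquare, normSq_I_mul,
    I_mul_re, I_mul_im, mul_neg, sub_neg_eq_add, ← neg_mul]

theorem mem_hurwitzK_twelve {z : ℂ} : z ∈ hurwitzK 12 ↔ z ∈ unitSquare ∧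
    normSq z + 2 * z.im + 2 * z.re + 1 ≤ 0 := by
  rw [hurwitzK_add_four 8, Set.mem_preimage, mem_hurwitzK_nine, I_mul_mem_unitSquare, normSq_I_mul,
    I_mul_re, I_mul_im, mul_neg, sub_neg_eq_add]

/-- Four quarter turns are the identity. -/
theorem hurwitzK_add_twelve (n : ℕ) : hurwitzK (n + 13) = hurwitzK (n + 1) := by
  rw [hurwitzK_add_four (n + 9), hurwitzK_add_four (n + 6), hurwitzK_add_four (n + 3),
    hurwitzK_add_four n]
  ext z
  simp [← mul_assoc]

theorem hurwitzK_subset_unitSquare : ∀ n, hurwitzK n ⊆ unitSquare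
  | 0 => Set.empty_subset _
  | 1 => Set.sep_subset _ _
  | 2 => Set.sep_subset _ _
  | 3 => Set.sep_subset _ _
  | n + 4 => fun z hz => by
    rw [hurwitzK_add_four] at hz
    exact I_mul_mem_unitSquare.1 (hurwitzK_subset_unitSquare (n + 1) hz)

/-! ### Closedness, nonemptiness and null boundaries -/

theorem isClosed_unitSquare : IsClosed unitSquare := by
  rw [unitSquare_eq_reProdIm]
  exact isClosed_Icc.reProdIm isClosed_Icc

theorem isClosed_hurwitzK : ∀ n, IsClosed (hurwitzK n)
  | 0 => isClosed_empty
  | 1 => isClosed_unitSquare.inter <| (isClosed_le continuous_re continuous_const).inter <|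
      (isClosed_le continuous_const (continuous_id.sub continuous_const).norm).inter <|
      isClosed_le continuous_const (continuous_id.add continuous_const).norm
  | 2 => isClosed_unitSquare.inter <|
      (isClosed_le (continuous_id.sub continuous_const).norm continuous_const).inter <|
      (isClosed_le (continuous_id.add continuous_const).norm continuous_const).inter <|
      isClosed_le continuous_const (continuous_id.sub continuous_const).norm
  | 3 => isClosed_unitSquare.inter <|
      isClosed_le (continuous_id.sub continuous_const).norm continuous_const
  | n + 4 => by
    rw [hurwitzK_add_four]
    exact (isClosed_hurwitzK (n + 1)).preimage (by fun_prop)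

theorem nonempty_hurwitzK : ∀ n, (hurwitzK (n + 1)).Nonempty
  | 0 => ⟨0, mem_hurwitzK_one.2 ⟨mem_unitSquare.2 (by norm_num), by simp⟩⟩
  | 1 => ⟨-1 / 4 + I / 4, mem_hurwitzK_two.2 ⟨mem_unitSquare.2 (by norm_num),
      by norm_num [normSq_apply]⟩⟩
  | 2 => ⟨-1 / 2 + I / 2, mem_hurwitzK_three.2 ⟨mem_unitSquare.2 (by norm_num),
      by norm_num [normSq_apply]⟩⟩
  | n + 3 => (nonempty_hurwitzK n).image _

theorem volume_frontier_inter_eq_zero {s t : Set ℂ} (hs : volume (frontier s) = 0)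
    (ht : volume (frontier t) = 0) : volume (frontier (s ∩ t)) = 0 :=
  measure_mono_null ((frontier_inter_subset s t).trans
    (Set.union_subset_union Set.inter_subset_left Set.inter_subset_right))
    (measure_union_null hs ht)

theorem convex_unitSquare : Convex ℝ unitSquare := by
  rw [unitSquare_eq_reProdIm]
  exact ((convex_Icc _ _).linear_preimage reLm).inter ((convex_Icc _ _).linear_preimage imLm)

theorem volume_frontier_unitSquare : volume (frontier unitSquare) = 0 :=
  convex_unitSquare.addHaar_frontier _

theorem volume_frontier_norm_sub_le (c : ℂ) : volume (frontier {z : ℂ | ‖z - c‖ ≤ 1}) = 0 := by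
  have : {z : ℂ | ‖z - c‖ ≤ 1} = Metric.closedBall c 1 := by
    ext z; simp [dist_eq]
  rw [this]
  exact (convex_closedBall c 1).addHaar_frontier _

theorem volume_frontier_le_norm_sub (c : ℂ) : volume (frontier {z : ℂ | 1 ≤ ‖z - c‖}) = 0 := by
  have : {z : ℂ | 1 ≤ ‖z - c‖} = (Metric.ball c 1)ᶜ := by
    ext z; simp [dist_eq]
  rw [this, frontier_compl]
  exact (convex_ball c 1).addHaar_frontier _

/-- Each defining condition is a convex set or the complement of one, hence has null boundary; the
rotation is linear and preserves null sets. -/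
theorem volume_frontier_hurwitzK : ∀ n, volume (frontier (hurwitzK n)) = 0
  | 0 => by simp [hurwitzK]
  | 1 => by
    have h := volume_frontier_le_norm_sub (-I)
    simp only [sub_neg_eq_add] at h
    exact volume_frontier_inter_eq_zero volume_frontier_unitSquare <|
      volume_frontier_inter_eq_zero ((convex_halfSpace_re_le 0).addHaar_frontier _) <|
      volume_frontier_inter_eq_zero (volume_frontier_le_norm_sub I) h
  | 2 => by
    have h := volume_frontier_norm_sub_le (-1)
    simp only [sub_neg_eq_add] at h
    exact volume_frontier_inter_eq_zero volume_frontier_unitSquare <|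
      volume_frontier_inter_eq_zero (volume_frontier_norm_sub_le I) <|
      volume_frontier_inter_eq_zero h (volume_frontier_le_norm_sub _)
  | 3 => volume_frontier_inter_eq_zero volume_frontier_unitSquare (volume_frontier_norm_sub_le _)
  | n + 4 => by
    have e : (fun z : ℂ => -I * z) = Homeomorph.mulLeft₀ (-I) (neg_ne_zero.2 I_ne_zero) := rfl
    have e' : (fun z : ℂ => -I * z) = LinearMap.mulLeft ℝ (-I) := rfl
    rw [hurwitzK, e, ← Homeomorph.image_frontier, ← e, e', Measure.addHaar_image_linearMap,
      volume_frontier_hurwitzK (n + 1), mul_zero]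

/-! ### Disjoint interiors and covering -/

/-- The unit circles around the nonzero Gaussian integers of absolute value at most `√2`. -/
def unitCircles : Set ℂ :=
  ⋃ c ∈ ({1, -1, I, -I, 1 + I, 1 - I, -1 + I, -1 - I} : Set ℂ), Metric.sphere c 1

theorem volume_unitCircles : volume unitCircles = 0 := by
  refine (measure_biUnion_null_iff (Set.Finite.countable (by simp))).2 fun c _ => ?_
  exact Measure.addHaar_sphere _ _ _

theorem mem_unitCircles {z : ℂ} : z ∈ unitCircles ↔
    normSq z = 2 * z.re ∨ normSq z = -2 * z.re ∨ normSq z = 2 * z.im ∨ normSq z = -2 * z.im ∨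
    normSq z - 2 * z.re - 2 * z.im + 1 = 0 ∨ normSq z - 2 * z.re + 2 * z.im + 1 = 0 ∨
    normSq z + 2 * z.re - 2 * z.im + 1 = 0 ∨ normSq z + 2 * z.re + 2 * z.im + 1 = 0 := by
  have key (c : ℂ) : z ∈ Metric.sphere c 1 ↔
      normSq z - 2 * (z.re * c.re + z.im * c.im) + normSq c = 1 := by
    rw [mem_sphere_iff_norm, le_antisymm_iff, le_antisymm_iff, one_le_norm_sub_iff,
      norm_sub_le_one_iff]
  simp only [unitCircles, Set.mem_iUnion, Set.mem_insert_iff, Set.mem_singleton_iff, exists_prop,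
    exists_eq_or_imp, exists_eq_left, key]
  simp only [normSq_apply, neg_re, neg_im, I_re, I_im, add_re, add_im, sub_re, sub_im, one_re,
    one_im]
  refine or_congr ?_ <| or_congr ?_ <| or_congr ?_ <| or_congr ?_ <| or_congr ?_ <|
    or_congr ?_ <| or_congr ?_ ?_ <;> constructor <;> intro h <;> linarith

/-- Off the circles every circle inequality is strict, and the systems for two different pieces are
then incompatible within the square. -/
theorem hurwitzPartition_inter_subset_unitCircles {i j : Fin 12} (hij : i < j) :
    hurwitzPartition i ∩ hurwitzPartition j ⊆ unitCircles := by
  rintro z ⟨hi, hj⟩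
  by_contra hz
  have h0 := normSq_nonneg z
  simp only [mem_unitCircles, not_or] at hz
  obtain ⟨n1, n2, n3, n4, n5, n6, n7, n8⟩ := hz
  have hs := mem_unitSquare.1 (hurwitzK_subset_unitSquare _ hi)
  obtain ⟨⟨s1, s2⟩, s3, s4⟩ := hs
  fin_cases i <;> fin_cases j <;> first | (exact absurd hij (by decide)) | skip
  all_goals
    simp only [hurwitzPartition, Nat.reduceAdd,
      mem_hurwitzK_one, mem_hurwitzK_two, mem_hurwitzK_three, mem_hurwitzK_four,
      mem_hurwitzK_five, mem_hurwitzK_six, mem_hurwitzK_seven, mem_hurwitzK_eight,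
      mem_hurwitzK_nine, mem_hurwitzK_ten, mem_hurwitzK_eleven, mem_hurwitzK_twelve] at hi hj
    grind

theorem disjoint_interior_hurwitzPartition {i j : Fin 12} (hij : i ≠ j) :
    Disjoint (interior (hurwitzPartition i)) (interior (hurwitzPartition j)) := by
  wlog h : i < j generalizing i j
  · exact (this hij.symm (lt_of_le_of_ne (not_lt.1 h) hij.symm)).symm
  -- An open null set is empty.
  rw [Set.disjoint_iff_inter_eq_empty, ← (isOpen_interior.inter isOpen_interior).measure_eq_zero_iff
    volume]
  exact measure_mono_null ((Set.inter_subset_inter interior_subset interior_subset).trans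
    (hurwitzPartition_inter_subset_unitCircles h)) volume_unitCircles

theorem iUnion_hurwitzPartition : ⋃ i, hurwitzPartition i = unitSquare := by
  refine subset_antisymm (Set.iUnion_subset fun i => hurwitzK_subset_unitSquare _) fun z hz => ?_
  rw [Set.mem_iUnion]
  by_contra! h
  simp only [Fin.forall_fin_succ, hurwitzPartition] at h
  simp [mem_hurwitzK_one, mem_hurwitzK_two, mem_hurwitzK_three, mem_hurwitzK_four,
      mem_hurwitzK_five, mem_hurwitzK_six, mem_hurwitzK_seven, mem_hurwitzK_eight,
      mem_hurwitzK_nine, mem_hurwitzK_ten, mem_hurwitzK_eleven, mem_hurwitzK_twelve, hz] at h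
  have := normSq_le_of_mem_unitSquare hz
  have h0 := normSq_nonneg z
  grind

/-! ### The inversion in coordinates -/

/-- `S` is an involution, so images become preimages. The condition `w ≠ 0` is needed because `invS
0 = 0` by convention. -/
theorem imageS_eq (s : Set ℂ) : imageS s = {w : ℂ | w ≠ 0 ∧ invS w ∈ s} := by
  have inv (z : ℂ) : invS (invS z) = z := by simp [invS, neg_div]
  have ne {z : ℂ} (hz : z ≠ 0) : invS z ≠ 0 := by simpa [invS, neg_div]
  ext w
  constructor
  · rintro ⟨z, ⟨hz, h0⟩, rfl⟩
    exact ⟨ne h0, by rwa [inv]⟩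
  · rintro ⟨h0, hw⟩
    exact ⟨invS w, ⟨hw, ne h0⟩, inv w⟩

theorem imageS_hurwitzK_add_three (n : ℕ) :
    imageS (hurwitzK (n + 4)) = (fun w : ℂ => I * w) '' imageS (hurwitzK (n + 1)) := by
  rw [image_I_mul, imageS_eq, imageS_eq, hurwitzK_add_four]
  ext w
  have e : I * invS w = invS (-I * w) := by
    rcases eq_or_ne w 0 with rfl | hw
    · simp [invS]
    · simp only [invS]
      field_simp
      simp
  simp [e]

theorem invS_re (w : ℂ) : (invS w).re = -w.re / normSq w := by
  simp [invS, div_re]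

theorem invS_im (w : ℂ) : (invS w).im = w.im / normSq w := by
  simp [invS, neg_div]

theorem normSq_invS (w : ℂ) : normSq (invS w) = 1 / normSq w := by
  simp [invS]

theorem invS_mem_unitSquare {w : ℂ} (hw : w ≠ 0) : invS w ∈ unitSquare ↔
    (2 * w.re ≤ normSq w ∧ -2 * w.re ≤ normSq w) ∧
    (2 * w.im ≤ normSq w ∧ -2 * w.im ≤ normSq w) := by
  have h := normSq_pos.2 hw
  rw [mem_unitSquare, invS_re, invS_im, le_div_iff₀ h, le_div_iff₀ h, div_le_iff₀ h, div_le_iff₀ h]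
  grind

theorem mem_imageS_hurwitzK_one {w : ℂ} : w ∈ imageS (hurwitzK 1) ↔
    1 / 2 ≤ w.re ∧ (-1 / 2 ≤ w.im ∧ w.im ≤ 1 / 2) ∧ 2 * w.re ≤ normSq w := by
  rw [imageS_eq, Set.mem_ofPred_eq]
  constructor
  · rintro ⟨hw, h⟩
    have h0 := normSq_pos.2 hw
    rw [mem_hurwitzK_one, invS_mem_unitSquare hw, invS_re, invS_im, normSq_invS] at h
    simp only [mul_div_assoc', div_le_div_iff_of_pos_right h0] at h
    grind
  · rintro ⟨h1, h2, h3⟩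
    have hw : w ≠ 0 := by
      rintro rfl
      norm_num at h1
    have h0 := normSq_pos.2 hw
    rw [mem_hurwitzK_one, invS_mem_unitSquare hw, invS_re, invS_im, normSq_invS]
    simp only [mul_div_assoc', div_le_div_iff_of_pos_right h0]
    grind

theorem mem_imageS_hurwitzK_two {w : ℂ} : w ∈ imageS (hurwitzK 2) ↔
    1 / 2 ≤ w.re ∧ 1 / 2 ≤ w.im ∧ 2 * w.re ≤ normSq w ∧ 2 * w.im ≤ normSq w ∧
      2 * w.re + 2 * w.im ≤ normSq w + 1 := by
  have key (hw : w ≠ 0) : 0 ≤ normSq (invS w) + 2 * (invS w).re - 2 * (invS w).im + 1 ↔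
      2 * w.re + 2 * w.im ≤ normSq w + 1 := by
    have h0 := normSq_pos.2 hw
    have e : normSq (invS w) + 2 * (invS w).re - 2 * (invS w).im + 1 =
        (normSq w + 1 - (2 * w.re + 2 * w.im)) / normSq w := by
      rw [invS_re, invS_im, normSq_invS]
      field_simp
      ring
    rw [e, le_div_iff₀ h0, zero_mul, sub_nonneg]
  rw [imageS_eq, Set.mem_ofPred_eq]
  constructor
  · rintro ⟨hw, h⟩
    have h0 := normSq_pos.2 hw
    rw [mem_hurwitzK_two, invS_mem_unitSquare hw, key hw, invS_re, invS_im, normSq_invS] at h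
    simp only [mul_div_assoc', div_le_div_iff_of_pos_right h0] at h
    grind
  · rintro ⟨h1, h2, h3⟩
    have hw : w ≠ 0 := by
      rintro rfl
      norm_num at h1
    have h0 := normSq_pos.2 hw
    rw [mem_hurwitzK_two, invS_mem_unitSquare hw, key hw, invS_re, invS_im, normSq_invS]
    simp only [mul_div_assoc', div_le_div_iff_of_pos_right h0]
    grind

/-- The last inequality says |w-(1+i)| ≤ 1, which forces both coordinates to be nonnegative, so two
of the four conditions from the square are automatic. -/
theorem mem_imageS_hurwitzK_three {w : ℂ} : w ∈ imageS (hurwitzK 3) ↔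
    2 * w.re ≤ normSq w ∧ 2 * w.im ≤ normSq w ∧ normSq w + 1 ≤ 2 * w.re + 2 * w.im := by
  have key (hw : w ≠ 0) : normSq (invS w) + 2 * (invS w).re - 2 * (invS w).im + 1 ≤ 0 ↔
      normSq w + 1 ≤ 2 * w.re + 2 * w.im := by
    have h0 := normSq_pos.2 hw
    have e : normSq (invS w) + 2 * (invS w).re - 2 * (invS w).im + 1 =
        (normSq w + 1 - (2 * w.re + 2 * w.im)) / normSq w := by
      rw [invS_re, invS_im, normSq_invS]
      field_simp
      ring
    rw [e, div_le_iff₀ h0, zero_mul, sub_nonpos]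
  rw [imageS_eq, Set.mem_ofPred_eq]
  constructor
  · rintro ⟨hw, h⟩
    rw [mem_hurwitzK_three, invS_mem_unitSquare hw, key hw] at h
    grind
  · rintro ⟨h1, h2, h3⟩
    have hw : w ≠ 0 := by
      rintro rfl
      norm_num at h3
    rw [mem_hurwitzK_three, invS_mem_unitSquare hw, key hw]
    grind

/-! ### Decomposing the images into translated pieces -/

theorem mem_gaussTranslate {a : GaussianInt} {s : Set ℂ} {w : ℂ} :
    w ∈ gaussTranslate a s ↔ w - a ∈ s := by
  simp [gaussTranslate, sub_eq_neg_add]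

theorem biUnion_gaussTranslate_hurwitzK (J : Finset ℕ) (a : GaussianInt) :
    ⋃ j ∈ J, gaussTranslate a (hurwitzK j) = gaussTranslate a (⋃ j ∈ J, hurwitzK j) := by
  simp only [gaussTranslate, Set.image_iUnion₂]

/-- The arcs between neighbouring pieces disappear in the union and only the circle around -1
remains. This and the next five unions are the shapes cut from a grid cell by the circles bounding
S(K_1), S(K_2), S(K_3). -/
theorem mem_biUnion_hurwitzK_four_ten {z : ℂ} : z ∈ ⋃ j ∈ Finset.Icc 4 10, hurwitzK j ↔
    z ∈ unitSquare ∧ 0 ≤ normSq z + 2 * z.re := by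
  have e : Finset.Icc 4 10 = {4, 5, 6, 7, 8, 9, 10} := by decide
  simp only [e, Finset.mem_insert, Finset.mem_singleton, Set.mem_iUnion, exists_prop,
    exists_eq_or_imp, exists_eq_left, mem_hurwitzK_four, mem_hurwitzK_five, mem_hurwitzK_six,
    mem_hurwitzK_seven, mem_hurwitzK_eight, mem_hurwitzK_nine, mem_hurwitzK_ten, ← and_or_left]
  refine and_congr_right fun hz => ?_
  have := normSq_le_of_mem_unitSquare hz
  have h0 := normSq_nonneg z
  rw [mem_unitSquare] at hz
  grind

theorem mem_biUnion_hurwitzK_one_seven {z : ℂ} : z ∈ ⋃ j ∈ Finset.Icc 1 7, hurwitzK j ↔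
    z ∈ unitSquare ∧ 0 ≤ normSq z + 2 * z.im := by
  have e : Finset.Icc 1 7 = {1, 2, 3, 4, 5, 6, 7} := by decide
  simp only [e, Finset.mem_insert, Finset.mem_singleton, Set.mem_iUnion, exists_prop,
    exists_eq_or_imp, exists_eq_left, mem_hurwitzK_four, mem_hurwitzK_five, mem_hurwitzK_six,
    mem_hurwitzK_seven, mem_hurwitzK_one, mem_hurwitzK_two, mem_hurwitzK_three, ← and_or_left]
  refine and_congr_right fun hz => ?_
  have := normSq_le_of_mem_unitSquare hz
  have h0 := normSq_nonneg z
  rw [mem_unitSquare] at hz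
  grind

theorem mem_biUnion_hurwitzK_one_eleven {z : ℂ} : z ∈ ⋃ j ∈ Finset.Icc 1 11, hurwitzK j ↔
    z ∈ unitSquare ∧ 0 ≤ normSq z + 2 * z.im + 2 * z.re + 1 := by
  have e : Finset.Icc 1 11 = {1, 2, 3, 4, 5, 6, 7, 8, 9, 10, 11} := by decide
  simp only [e, Finset.mem_insert, Finset.mem_singleton, Set.mem_iUnion, exists_prop,
    exists_eq_or_imp, exists_eq_left, mem_hurwitzK_four, mem_hurwitzK_five, mem_hurwitzK_six,
    mem_hurwitzK_seven, mem_hurwitzK_one, mem_hurwitzK_two, mem_hurwitzK_three,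
    mem_hurwitzK_eight, mem_hurwitzK_nine, mem_hurwitzK_ten, mem_hurwitzK_eleven, ← and_or_left]
  refine and_congr_right fun hz => ?_
  have := normSq_le_of_mem_unitSquare hz
  have h0 := normSq_nonneg z
  rw [mem_unitSquare] at hz
  grind

theorem mem_biUnion_hurwitzK_four_seven {z : ℂ} : z ∈ ⋃ j ∈ Finset.Icc 4 7, hurwitzK j ↔
    z ∈ unitSquare ∧ 0 ≤ normSq z + 2 * z.re ∧ 0 ≤ normSq z + 2 * z.im := by
  have e : Finset.Icc 4 7 = {4, 5, 6, 7} := by decide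
  simp only [e, Finset.mem_insert, Finset.mem_singleton, Set.mem_iUnion, exists_prop,
    exists_eq_or_imp, exists_eq_left, mem_hurwitzK_four, mem_hurwitzK_five, mem_hurwitzK_six,
    mem_hurwitzK_seven, ← and_or_left]
  refine and_congr_right fun hz => ?_
  have := normSq_le_of_mem_unitSquare hz
  have h0 := normSq_nonneg z
  rw [mem_unitSquare] at hz
  grind

theorem mem_biUnion_hurwitzK_left {z : ℂ} :
    z ∈ ⋃ j ∈ ({1, 2, 3, 11} : Finset ℕ), hurwitzK j ↔
    z ∈ unitSquare ∧ normSq z + 2 * z.re ≤ 0 ∧ 0 ≤ normSq z + 2 * z.im + 2 * z.re + 1 := by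
  simp only [Finset.mem_insert, Finset.mem_singleton, Set.mem_iUnion, exists_prop,
    exists_eq_or_imp, exists_eq_left, mem_hurwitzK_one, mem_hurwitzK_two, mem_hurwitzK_three,
    mem_hurwitzK_eleven, ← and_or_left]
  refine and_congr_right fun hz => ?_
  have h0 := normSq_nonneg z
  rw [mem_unitSquare] at hz
  grind

theorem mem_biUnion_hurwitzK_eight_eleven {z : ℂ} : z ∈ ⋃ j ∈ Finset.Icc 8 11, hurwitzK j ↔
    z ∈ unitSquare ∧ normSq z + 2 * z.im ≤ 0 ∧ 0 ≤ normSq z + 2 * z.im + 2 * z.re + 1 := by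
  have e : Finset.Icc 8 11 = {8, 9, 10, 11} := by decide
  simp only [e, Finset.mem_insert, Finset.mem_singleton, Set.mem_iUnion, exists_prop,
    exists_eq_or_imp, exists_eq_left, mem_hurwitzK_eight, mem_hurwitzK_nine, mem_hurwitzK_ten,
    mem_hurwitzK_eleven, ← and_or_left]
  refine and_congr_right fun hz => ?_
  have h0 := normSq_nonneg z
  rw [mem_unitSquare] at hz
  grind

theorem sub_gaussianInt_mem_unitSquare {w : ℂ} {n m : ℤ} :
    w - ((⟨n, m⟩ : GaussianInt) : ℂ) ∈ unitSquare ↔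
    ((n : ℝ) - 1 / 2 ≤ w.re ∧ w.re ≤ n + 1 / 2) ∧ ((m : ℝ) - 1 / 2 ≤ w.im ∧ w.im ≤ m + 1 / 2) := by
  simp only [mem_unitSquare, sub_re, sub_im, GaussianInt.re_toComplex, GaussianInt.im_toComplex]
  grind

/-- The strict upper bound sends x = 1/2 to n = 1, so x ≥ 1/2 gives n ≥ 1 below. -/
theorem exists_int_abs_sub_le (x : ℝ) : ∃ n : ℤ, (n : ℝ) - 1 / 2 ≤ x ∧ x < n + 1 / 2 :=
  ⟨⌊x + 1 / 2⌋, by linarith [Int.floor_le (x + 1 / 2)], by linarith [Int.lt_floor_add_one (x + 1 / 2)]⟩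

theorem normSq_sub_gaussianInt (w : ℂ) (n m : ℤ) :
    normSq (w - ((⟨n, m⟩ : GaussianInt) : ℂ)) =
      normSq w - 2 * w.re * n - 2 * w.im * m + n ^ 2 + m ^ 2 := by
  simp only [normSq_apply, sub_re, sub_im, GaussianInt.re_toComplex, GaussianInt.im_toComplex]
  ring

theorem imageS_hurwitzK_one : imageS (hurwitzK 1) =
    (⋃ j ∈ Finset.Icc 4 10, gaussTranslate ⟨2, 0⟩ (hurwitzK j)) ∪
    (⋃ n : ℤ, ⋃ _ : 3 ≤ n, gaussTranslate ⟨n, 0⟩ unitSquare) := by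
  ext w
  simp only [biUnion_gaussTranslate_hurwitzK, Set.mem_union,
    mem_gaussTranslate, mem_biUnion_hurwitzK_four_ten, sub_gaussianInt_mem_unitSquare,
    mem_imageS_hurwitzK_one, normSq_sub_gaussianInt, sub_re, GaussianInt.re_toComplex]
  simp only [Set.mem_iUnion, exists_prop, mem_gaussTranslate, sub_gaussianInt_mem_unitSquare]
  constructor
  · rintro ⟨h1, h2, h3⟩
    obtain ⟨n, hn, hn'⟩ := exists_int_abs_sub_le w.re
    have n1 : 1 ≤ n := by
      have : (0 : ℝ) < n := by linarith
      exact_mod_cast this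
    rcases lt_or_ge n 3 with n3 | n3
    · interval_cases n
      -- The cell around 1 lies within √2/2 of 1, inside the excluded open disc.
      · exfalso
        rw [normSq_apply] at h3
        push_cast at hn hn'
        nlinarith
      · left
        push_cast at hn hn' ⊢
        grind
    · exact Or.inr ⟨n, n3, ⟨hn, hn'.le⟩, by push_cast; constructor <;> linarith⟩
  · rintro (⟨h, h'⟩ | ⟨n, h3, h, h'⟩)
    · push_cast at h h'
      grind
    · have h4 : (3 : ℝ) ≤ n := by exact_mod_cast h3
      push_cast at h'
      refine ⟨by linarith, by grind, ?_⟩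
      rw [normSq_apply]
      nlinarith

theorem imageS_hurwitzK_two : imageS (hurwitzK 2) =
    (⋃ j ∈ Finset.Icc 4 10, gaussTranslate ⟨2, 1⟩ (hurwitzK j)) ∪
    (⋃ j ∈ Finset.Icc 1 7, gaussTranslate ⟨1, 2⟩ (hurwitzK j)) ∪
    (⋃ j ∈ Finset.Icc 1 11, gaussTranslate ⟨2, 2⟩ (hurwitzK j)) ∪
    (⋃ n : ℤ, ⋃ m : ℤ, ⋃ _ : 1 ≤ min m n ∧ 3 ≤ max m n, gaussTranslate ⟨n, m⟩ unitSquare) := by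
  ext w
  simp only [biUnion_gaussTranslate_hurwitzK, Set.mem_union,
    mem_gaussTranslate, mem_biUnion_hurwitzK_four_ten, mem_biUnion_hurwitzK_one_seven,
    mem_biUnion_hurwitzK_one_eleven, sub_gaussianInt_mem_unitSquare, mem_imageS_hurwitzK_two,
    normSq_sub_gaussianInt, sub_re, sub_im, GaussianInt.re_toComplex, GaussianInt.im_toComplex]
  simp only [Set.mem_iUnion, exists_prop, mem_gaussTranslate, sub_gaussianInt_mem_unitSquare,
    le_min_iff, le_max_iff]
  constructor
  · rintro ⟨h1, h2, h3, h4, h5⟩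
    obtain ⟨n, hn, hn'⟩ := exists_int_abs_sub_le w.re
    obtain ⟨m, hm, hm'⟩ := exists_int_abs_sub_le w.im
    have n1 : 1 ≤ n := by
      have : (0 : ℝ) < n := by linarith
      exact_mod_cast this
    have m1 : 1 ≤ m := by
      have : (0 : ℝ) < m := by linarith
      exact_mod_cast this
    by_cases h : 3 ≤ m ∨ 3 ≤ n
    · exact Or.inr ⟨n, m, ⟨⟨m1, n1⟩, h⟩, ⟨hn, hn'.le⟩, hm, hm'.le⟩
    · left
      obtain ⟨m3, n3⟩ := not_or.1 h
      rw [not_le] at m3 n3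
      interval_cases n <;> interval_cases m <;> push_cast at hn hn' hm hm' ⊢
      -- The cell around 1+i lies inside the excluded open disc |w-(1+i)| < 1.
      · exfalso
        rw [normSq_apply] at h5
        nlinarith
      all_goals grind
  · have hq := normSq_apply w
    rintro (((⟨h, h'⟩ | ⟨h, h'⟩) | ⟨h, h'⟩) | ⟨n, m, ⟨⟨m1, n1⟩, h3⟩, ⟨hn, hn'⟩, hm, hm'⟩)
    · push_cast at h h'
      obtain ⟨⟨a1, a2⟩, a3, a4⟩ := h
      refine ⟨by linarith, by linarith, by nlinarith, by nlinarith, by nlinarith⟩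
    · push_cast at h h'
      obtain ⟨⟨a1, a2⟩, a3, a4⟩ := h
      refine ⟨by linarith, by linarith, by nlinarith, by nlinarith, by nlinarith⟩
    · push_cast at h h'
      obtain ⟨⟨a1, a2⟩, a3, a4⟩ := h
      refine ⟨by linarith, by linarith, by nlinarith, by nlinarith, by nlinarith⟩
    · have m1' : (1 : ℝ) ≤ m := by exact_mod_cast m1
      have n1' : (1 : ℝ) ≤ n := by exact_mod_cast n1
      have h3' : (3 : ℝ) ≤ m ∨ (3 : ℝ) ≤ n := by exact_mod_cast h3
      have u1 : 1 / 2 ≤ w.re := by linarith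
      have v1 : 1 / 2 ≤ w.im := by linarith
      refine ⟨u1, v1, ?_⟩
      rcases h3' with h3' | h3'
      · have v2 : 5 / 2 ≤ w.im := by linarith
        refine ⟨by nlinarith [sq_nonneg (w.re - 1)], by nlinarith,
          by nlinarith [sq_nonneg (w.re - 1)]⟩
      · have v2 : 5 / 2 ≤ w.re := by linarith
        refine ⟨by nlinarith, by nlinarith [sq_nonneg (w.im - 1)],
          by nlinarith [sq_nonneg (w.im - 1)]⟩

theorem imageS_hurwitzK_three : imageS (hurwitzK 3) =
    (⋃ j ∈ Finset.Icc 4 7, gaussTranslate ⟨1, 1⟩ (hurwitzK j)) ∪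
    (⋃ j ∈ ({1, 2, 3, 11} : Finset ℕ), gaussTranslate ⟨2, 1⟩ (hurwitzK j)) ∪
    (⋃ j ∈ Finset.Icc 8 11, gaussTranslate ⟨1, 2⟩ (hurwitzK j)) ∪
    gaussTranslate ⟨2, 2⟩ (hurwitzK 12) := by
  ext w
  have hq := normSq_apply w
  simp only [biUnion_gaussTranslate_hurwitzK, Set.mem_union,
    mem_gaussTranslate, mem_biUnion_hurwitzK_four_seven, mem_biUnion_hurwitzK_left,
    mem_biUnion_hurwitzK_eight_eleven, mem_hurwitzK_twelve, sub_gaussianInt_mem_unitSquare,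
    mem_imageS_hurwitzK_three, normSq_sub_gaussianInt, sub_re, sub_im, GaussianInt.re_toComplex,
    GaussianInt.im_toComplex]
  constructor
  · rintro ⟨h1, h2, h3⟩
    obtain ⟨n, hn, hn'⟩ := exists_int_abs_sub_le w.re
    obtain ⟨m, hm, hm'⟩ := exists_int_abs_sub_le w.im
    -- The disc |w-(1+i)| ≤ 1 bounds the coordinates above, and combining `h3` with `h2` or `h1`
    -- bounds them below by 1/2. Only four cells remain.
    have u2 : w.re ≤ 2 := by nlinarith [sq_nonneg (w.im - 1)]
    have v2 : w.im ≤ 2 := by nlinarith [sq_nonneg (w.re - 1)]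
    have n1 : 1 ≤ n := by
      have : (0 : ℝ) < n := by linarith
      exact_mod_cast this
    have m1 : 1 ≤ m := by
      have : (0 : ℝ) < m := by linarith
      exact_mod_cast this
    have n3 : n < 3 := by
      have : (n : ℝ) < 3 := by linarith
      exact_mod_cast this
    have m3 : m < 3 := by
      have : (m : ℝ) < 3 := by linarith
      exact_mod_cast this
    clear hq
    interval_cases n <;> interval_cases m <;> push_cast at hn hn' hm hm' ⊢ <;> grind
  · rintro (((⟨h, h'⟩ | ⟨h, h'⟩) | ⟨h, h'⟩) | ⟨h, h'⟩) <;> push_cast at h h' <;>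
      obtain ⟨⟨a1, a2⟩, a3, a4⟩ := h <;>
      refine ⟨by nlinarith, by nlinarith, by nlinarith⟩

/-! ### Unions of translates, closed under rotation -/

/-- A set that is a union of translates of the twelve pieces by Gaussian integers. -/
def IsTranslateUnion (s : Set ℂ) : Prop :=
  ∃ A : Set (GaussianInt × Fin 12),
    s = ⋃ p ∈ A, gaussTranslate p.1 (hurwitzPartition p.2)

theorem IsTranslateUnion.iUnion {ι : Sort*} {s : ι → Set ℂ} (h : ∀ i, IsTranslateUnion (s i)) :
    IsTranslateUnion (⋃ i, s i) := by
  choose A hA using h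
  refine ⟨⋃ i, A i, ?_⟩
  rw [Set.biUnion_iUnion]
  exact Set.iUnion_congr hA

theorem IsTranslateUnion.union {s t : Set ℂ} (hs : IsTranslateUnion s) (ht : IsTranslateUnion t) :
    IsTranslateUnion (s ∪ t) := by
  rw [Set.union_eq_iUnion]
  exact .iUnion (Bool.rec ht hs)

theorem isTranslateUnion_gaussTranslate (a : GaussianInt) {n : ℕ} (h1 : 1 ≤ n) (h2 : n ≤ 12) :
    IsTranslateUnion (gaussTranslate a (hurwitzK n)) := by
  obtain ⟨n, rfl⟩ := Nat.exists_eq_add_of_le' h1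
  exact ⟨{(a, ⟨n, h2⟩)}, by simp [hurwitzPartition]⟩

theorem isTranslateUnion_biUnion (a : GaussianInt) {J : Finset ℕ} (hJ : J ⊆ Finset.Icc 1 12) :
    IsTranslateUnion (⋃ j ∈ J, gaussTranslate a (hurwitzK j)) :=
  .iUnion fun _ => .iUnion fun h =>
    isTranslateUnion_gaussTranslate a (Finset.mem_Icc.1 (hJ h)).1 (Finset.mem_Icc.1 (hJ h)).2

theorem isTranslateUnion_unitSquare (a : GaussianInt) :
    IsTranslateUnion (gaussTranslate a unitSquare) := by
  rw [← iUnion_hurwitzPartition, gaussTranslate, Set.image_iUnion]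
  exact .iUnion fun i => isTranslateUnion_gaussTranslate a (Nat.le_add_left _ _) i.2

theorem IsTranslateUnion.I_mul {s : Set ℂ} (hs : IsTranslateUnion s) :
    IsTranslateUnion ((fun w : ℂ => I * w) '' s) := by
  obtain ⟨A, rfl⟩ := hs
  simp only [Set.image_iUnion]
  refine .iUnion fun p => .iUnion fun _ => ?_
  -- Rotation by i lowers the index by 3; modulo 12 this is raising it by 9, which avoids natural
  -- subtraction.
  have e : (fun w : ℂ => I * w) '' gaussTranslate p.1 (hurwitzPartition p.2) =
      gaussTranslate (⟨0, 1⟩ * p.1) (hurwitzK ((p.2 : ℕ) + 9 + 1)) := by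
    ext w
    rw [image_I_mul, Set.mem_preimage, mem_gaussTranslate, mem_gaussTranslate, hurwitzPartition,
      ← hurwitzK_add_twelve, hurwitzK_add_four ((p.2 : ℕ) + 9), Set.mem_preimage]
    have : I * (-I * w - p.1) = w - ((⟨0, 1⟩ * p.1 : GaussianInt) : ℂ) := by
      rw [map_mul, mul_sub, ← mul_assoc, GaussianInt.toComplex_def' 0 1]
      simp
    rw [this]
  rw [e]
  obtain ⟨j, hj⟩ := p.2
  rcases lt_or_ge j 3 with h | h
  · exact isTranslateUnion_gaussTranslate _ (Nat.le_add_left _ _) (by simp only; omega)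
  · obtain ⟨k, rfl⟩ := Nat.exists_eq_add_of_le' h
    change IsTranslateUnion (gaussTranslate _ (hurwitzK (k + 13)))
    rw [hurwitzK_add_twelve]
    exact isTranslateUnion_gaussTranslate _ (Nat.le_add_left _ _) (by omega)

theorem isTranslateUnion_imageS_hurwitzK : ∀ n, IsTranslateUnion (imageS (hurwitzK (n + 1)))
  | 0 => by
    rw [imageS_hurwitzK_one]
    exact (isTranslateUnion_biUnion _ (by decide)).union
      (.iUnion fun _ => .iUnion fun _ => isTranslateUnion_unitSquare _)
  | 1 => by
    rw [imageS_hurwitzK_two]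
    exact (((isTranslateUnion_biUnion _ (by decide)).union
      (isTranslateUnion_biUnion _ (by decide))).union
      (isTranslateUnion_biUnion _ (by decide))).union
      (.iUnion fun _ => .iUnion fun _ => .iUnion fun _ => isTranslateUnion_unitSquare _)
  | 2 => by
    rw [imageS_hurwitzK_three]
    exact (((isTranslateUnion_biUnion _ (by decide)).union
      (isTranslateUnion_biUnion _ (by decide))).union
      (isTranslateUnion_biUnion _ (by decide))).union
      (isTranslateUnion_gaussTranslate _ (by decide) (by decide))
  | n + 3 => by
    rw [imageS_hurwitzK_add_three]
    exact (isTranslateUnion_imageS_hurwitzK n).I_mul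

/-! ### Nearest integer functions and the building property -/

theorem IsNearestInteger.sub_mem_unitSquare {br : ℂ → GaussianInt} (hbr : IsNearestInteger br)
    {z : ℂ} (hz : z ≠ 0) : z - br z ∈ unitSquare := by
  have key (a : GaussianInt) : normSq (z - br z) ≤ normSq (z - br z - a) := by
    have h := hbr z hz (br z + a)
    rw [map_add, ← sub_sub] at h
    rw [← Complex.sq_norm, ← Complex.sq_norm]
    gcongr
  generalize z - (br z : ℂ) = w at key ⊢
  -- Comparison with the four neighbours of the nearest integer gives the four sides of the square.
  have h1 := key ⟨1, 0⟩
  have h2 := key ⟨-1, 0⟩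
  have h3 := key ⟨0, 1⟩
  have h4 := key ⟨0, -1⟩
  rw [normSq_sub_gaussianInt] at h1 h2 h3 h4
  push_cast at h1 h2 h3 h4
  rw [mem_unitSquare]
  refine ⟨⟨by linarith, by linarith⟩, by linarith, by linarith⟩

theorem interior_unitSquare : interior unitSquare =
    Set.Ioo (-1 / 2 : ℝ) (1 / 2) ×ℂ Set.Ioo (-1 / 2 : ℝ) (1 / 2) := by
  rw [unitSquare_eq_reProdIm, interior_reProdIm, interior_Icc]

theorem eq_of_sub_mem_unitSquare {z : ℂ} {a b : GaussianInt} (ha : z - a ∈ interior unitSquare)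
    (hb : z - b ∈ unitSquare) : a = b := by
  obtain ⟨n, m⟩ := a
  obtain ⟨k, l⟩ := b
  rw [interior_unitSquare, mem_reProdIm] at ha
  rw [sub_gaussianInt_mem_unitSquare] at hb
  simp only [sub_re, sub_im, GaussianInt.re_toComplex, GaussianInt.im_toComplex, Set.mem_Ioo] at ha
  obtain ⟨⟨a1, a2⟩, a3, a4⟩ := ha
  obtain ⟨⟨b1, b2⟩, b3, b4⟩ := hb
  have c1 : (n : ℝ) < k + 1 := by linarith
  have c2 : (k : ℝ) < n + 1 := by linarith
  have c3 : (m : ℝ) < l + 1 := by linarith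
  have c4 : (l : ℝ) < m + 1 := by linarith
  norm_cast at c1 c2 c3 c4
  ext
  · simp only; omega
  · simp only; omega

theorem IsNearestInteger.fundamentalSet_eq {br : ℂ → GaussianInt} (hbr : IsNearestInteger br) :
    fundamentalSet br = unitSquare := by
  refine subset_antisymm (closure_minimal ?_ isClosed_unitSquare) ?_
  · rintro _ ⟨z, hz, rfl⟩
    exact hbr.sub_mem_unitSquare hz
  · have e : closure (interior unitSquare) = unitSquare := by
      rw [interior_unitSquare, unitSquare_eq_reProdIm, closure_reProdIm,
        closure_Ioo (by norm_num)]
    rw [← e]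
    refine closure_mono fun u hu => ?_
    -- Shifting by 1 avoids the origin, where `br` is unconstrained.
    have h0 : 1 + u ≠ 0 := by
      intro h
      have h' := (mem_unitSquare.1 (interior_subset hu)).1.1
      rw [eq_neg_of_add_eq_zero_right h] at h'
      norm_num at h'
    have h1 : (1 : GaussianInt) = br (1 + u) :=
      eq_of_sub_mem_unitSquare (by simpa using hu) (hbr.sub_mem_unitSquare h0)
    exact ⟨1 + u, h0, by simp [← h1]⟩

theorem IsNearestInteger.isChoiceFunction {br : ℂ → GaussianInt} (hbr : IsNearestInteger br) :
    IsChoiceFunction br := by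
  intro z hz
  obtain ⟨⟨h1, h2⟩, h3, h4⟩ := mem_unitSquare.1 (hbr.sub_mem_unitSquare hz)
  rw [← sq_le_one_iff₀ (norm_nonneg _), Complex.sq_norm, normSq_apply]
  nlinarith

/-- The convention G(0) = 0 can add at most the point 0 to the reduction of S(s). -/
theorem gaussMap_image (br : ℂ → GaussianInt) (s : Set ℂ) :
    gaussMap br '' s \ {0} ⊆ (fun w => w - (br w : ℂ)) '' imageS s ∧
    (fun w => w - (br w : ℂ)) '' imageS s ⊆ gaussMap br '' s := by
  constructor
  · rintro _ ⟨⟨z, hz, rfl⟩, h0⟩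
    rcases eq_or_ne z 0 with rfl | hz0
    · simp [gaussMap] at h0
    · exact ⟨invS z, ⟨z, ⟨hz, hz0⟩, rfl⟩, by simp [gaussMap, hz0]⟩
  · rintro _ ⟨_, ⟨z, ⟨hz, hz0⟩, rfl⟩, rfl⟩
    exact ⟨z, hz, if_neg hz0⟩

theorem IsNearestInteger.isBuildable {br : ℂ → GaussianInt} (hbr : IsNearestInteger br)
    {s : Set ℂ} (hs : IsTranslateUnion (imageS s)) :
    IsBuildable (Set.range hurwitzPartition) (gaussMap br '' s) := by
  obtain ⟨A, hA⟩ := hs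
  obtain ⟨h1, h2⟩ := gaussMap_image br s
  have ne {w : ℂ} (hw : w ∈ imageS s) : w ≠ 0 := by
    rw [imageS_eq] at hw
    exact hw.1
  -- The pieces used are all those having some translate in S(s).
  refine ⟨hurwitzPartition '' (Prod.snd '' A), Set.image_subset_range _ _, ?_⟩
  have n1 : volume (frontier unitSquare ∪ {0}) = 0 :=
    measure_union_null volume_frontier_unitSquare (measure_singleton _)
  rw [isClosed_unitSquare.frontier_eq] at n1
  refine Filter.EventuallyLE.antisymm (ae_le_set.2 (measure_mono_null ?_ n1))
    (ae_le_set.2 (measure_mono_null ?_ n1))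
  · rintro u ⟨hu, hu'⟩
    by_contra hn
    rw [Set.mem_union, not_or] at hn
    obtain ⟨w, hw, rfl⟩ := h1 ⟨hu, hn.2⟩
    have hsq := hbr.sub_mem_unitSquare (ne hw)
    have hint : w - (br w : ℂ) ∈ interior unitSquare := by
      by_contra h
      exact hn.1 ⟨hsq, h⟩
    have hw' := hw
    rw [hA, Set.mem_iUnion₂] at hw'
    obtain ⟨p, hp, hwp⟩ := hw'
    rw [mem_gaussTranslate] at hwp
    have e := eq_of_sub_mem_unitSquare hint (hurwitzK_subset_unitSquare _ hwp)
    rw [← e] at hwp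
    exact hu' ⟨_, ⟨p.2, ⟨p, hp, rfl⟩, rfl⟩, hwp⟩
  · rintro u ⟨⟨_, ⟨_, ⟨p, hp, rfl⟩, rfl⟩, hu⟩, hu'⟩
    refine Or.inl ⟨hurwitzK_subset_unitSquare _ hu, fun hint => hu' (h2 ?_)⟩
    have hw : (p.1 : ℂ) + u ∈ imageS s := by
      rw [hA]
      exact Set.mem_biUnion hp ⟨u, hu, rfl⟩
    have e : p.1 = br (p.1 + u) :=
      eq_of_sub_mem_unitSquare (by simpa using hint) (hbr.sub_mem_unitSquare (ne hw))
    exact ⟨p.1 + u, hw, by simp [← e]⟩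

theorem IsNearestInteger.finiteBuildingPropertyWith {br : ℂ → GaussianInt}
    (hbr : IsNearestInteger br) : FiniteBuildingPropertyWith br hurwitzPartition := by
  refine ⟨by decide, ?_, fun i => hbr.isBuildable (isTranslateUnion_imageS_hurwitzK i)⟩
  rw [hbr.fundamentalSet_eq]
  exact {
    nonempty := fun i => nonempty_hurwitzK i
    isClosed := fun i => isClosed_hurwitzK _
    null_frontier := fun i => volume_frontier_hurwitzK _
    iUnion_eq := iUnion_hurwitzPartition
    disjoint_interior := fun i j h => disjoint_interior_hurwitzPartition h }

theorem mainTheorem7 (br : ℂ → GaussianInt) (hbr : IsNearestInteger br) :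
    -- the nearest integer function is a choice function, and its fundamental set is the unit square
    IsChoiceFunction br ∧ fundamentalSet br = unitSquare ∧
    -- the finite building property, with the explicit twelve pieces
    FiniteBuildingPropertyWith br hurwitzPartition ∧
    -- each `S(K_i)` is exactly a union of Gaussian integer translates of pieces
    (∀ i : Fin 12, ∃ A : Set (GaussianInt × Fin 12),
      imageS (hurwitzPartition i) = ⋃ p ∈ A, gaussTranslate p.1 (hurwitzPartition p.2)) ∧
    -- explicitly for `i = 1, 2, 3`
    imageS (hurwitzK 1) =
      (⋃ j ∈ Finset.Icc 4 10, gaussTranslate ⟨2, 0⟩ (hurwitzK j)) ∪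
      (⋃ n : ℤ, ⋃ _ : 3 ≤ n, gaussTranslate ⟨n, 0⟩ unitSquare) ∧
    imageS (hurwitzK 2) =
      (⋃ j ∈ Finset.Icc 4 10, gaussTranslate ⟨2, 1⟩ (hurwitzK j)) ∪
      (⋃ j ∈ Finset.Icc 1 7, gaussTranslate ⟨1, 2⟩ (hurwitzK j)) ∪
      (⋃ j ∈ Finset.Icc 1 11, gaussTranslate ⟨2, 2⟩ (hurwitzK j)) ∪
      (⋃ n : ℤ, ⋃ m : ℤ, ⋃ _ : 1 ≤ min m n ∧ 3 ≤ max m n, gaussTranslate ⟨n, m⟩ unitSquare) ∧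
    imageS (hurwitzK 3) =
      (⋃ j ∈ Finset.Icc 4 7, gaussTranslate ⟨1, 1⟩ (hurwitzK j)) ∪
      (⋃ j ∈ ({1, 2, 3, 11} : Finset ℕ), gaussTranslate ⟨2, 1⟩ (hurwitzK j)) ∪
      (⋃ j ∈ Finset.Icc 8 11, gaussTranslate ⟨1, 2⟩ (hurwitzK j)) ∪
      gaussTranslate ⟨2, 2⟩ (hurwitzK 12) ∧
    -- the other nine are rotations of these
    (∀ i : ℕ, 1 ≤ i → imageS (hurwitzK (i + 3)) = (fun w : ℂ => Complex.I * w) '' imageS (hurwitzK i)) := by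
  refine ⟨hbr.isChoiceFunction, hbr.fundamentalSet_eq, hbr.finiteBuildingPropertyWith,
    fun i => isTranslateUnion_imageS_hurwitzK i, imageS_hurwitzK_one, imageS_hurwitzK_two,
    imageS_hurwitzK_three, fun i hi => ?_⟩
  obtain ⟨n, rfl⟩ := Nat.exists_eq_add_of_le' hi
  exact imageS_hurwitzK_add_three n
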